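/- Let $\mathbb K$ be a field of characteristic $0$, let $k\ge 0$, let $F_0(u)\in\mathbb K[u]$ and let $Q(y_0,y_1,\ldots,y_k,t,v)$ be a polynomial in $k+3$ indeterminates with coefficients in $\mathbb K$. For a series $F(u)\equiv F(t,u)\in\mathbb K[u][[t]]$, let $\Delta F(u)=\dfrac{F(u)-F(0)}{u}$ be its divided difference with respect to $u$, where $F(0)=F(t,0)$, and let $\Delta^{(i)}$ denote $\Delta$ applied $i$ times. Then the equation $$F(u)=F_0(u)+t\,Q\bigl(F(u),\Delta F(u),\Delta^{(2)}F(u),\ldots,\Delta^{(k)}F(u),t,u\bigr)$$ has a unique solution $F(t,u)$ in $\mathbb K[u][[t]]$. This series $F(t,u)$ is algebraic over $\mathbb K(t,u)$. Moreover, for every $i\ge 1$, the series $F_i(t)\in\mathbb K[[t]]$, defined as the coefficient of $u^{i-1}$ in $F(t,u)$, is algebraic over $\mathbb K(t)$ (and hence over $\mathbb K(t,u)$). -/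

import Mathlib

namespace Catalytic

variable {K : Type*} [Field K]

/-- The variable `t` of `K[u][[t]]`. -/
noncomputable def tVar (K : Type*) [Field K] : PowerSeries (Polynomial K) :=
  PowerSeries.X

/-- The catalytic variable `u` of `K[u][[t]]`. -/
noncomputable def uVar (K : Type*) [Field K] : PowerSeries (Polynomial K) :=
  PowerSeries.C Polynomial.X

/-- The series `[u^i] F(t,u)` of `K[[t]]`. -/
noncomputable def uCoeff (i : ℕ) (F : PowerSeries (Polynomial K)) : PowerSeries K :=
  PowerSeries.mk fun n => (PowerSeries.coeff n F).coeff i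

/-- The divided difference `Δ F(u) = (F(u) - F(0)) / u` on `K[u][[t]]`. The division is performed
on each coefficient of `t^n`; see `uVar_mul_divDiff`. -/
noncomputable def divDiff (F : PowerSeries (Polynomial K)) : PowerSeries (Polynomial K) :=
  PowerSeries.mk fun n => (PowerSeries.coeff n F).divX

/-- `u * Δ F(u) = F(u) - F(0)`, where `F(0) = [u^0] F` is viewed in `K[u][[t]]`. -/
theorem uVar_mul_divDiff (F : PowerSeries (Polynomial K)) :
    uVar K * divDiff F = F - PowerSeries.map Polynomial.C (uCoeff 0 F) := by
  ext1 n
  simp only [uVar, divDiff, uCoeff, PowerSeries.coeff_C_mul, PowerSeries.coeff_mk, map_sub,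
    PowerSeries.coeff_map]
  exact eq_sub_of_add_eq (Polynomial.X_mul_divX_add _)

/-- `F` satisfies `F(u) = F₀(u) + t Q(F(u), Δ F(u), …, Δ^(k) F(u), t, u)`. The indeterminates
of `Q` are `y_0, …, y_k` (left summand) and `t, v` (right summand, in this order). -/
def IsSolution {k : ℕ} (F₀ : Polynomial K) (Q : MvPolynomial (Fin (k + 1) ⊕ Fin 2) K)
    (F : PowerSeries (Polynomial K)) : Prop :=
  F = PowerSeries.C F₀ + tVar K *
    MvPolynomial.aeval
      (Sum.elim (fun i : Fin (k + 1) => divDiff^[(i : ℕ)] F) ![tVar K, uVar K]) Q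

/-- `a` is algebraic over the field `K(s)`, the subfield of the fraction field of the
`K`-algebra `A` generated by `K` and `s`. -/
def IsAlgebraicOver (K : Type*) [Field K] {A : Type*} [CommRing A] [IsDomain A] [Algebra K A]
    (s : Set A) (a : A) : Prop :=
  IsAlgebraic (IntermediateField.adjoin K (algebraMap A (FractionRing A) '' s))
    (algebraMap A (FractionRing A) a)

end Catalytic

namespace Catalytic

/-! Existence and uniqueness hold because the factor `t` makes the right-hand side a `t`-adic
contraction. Algebraicity is proved with derivations: in characteristic zero an element
transcendental over a field is moved by some derivation over that field
(`exists_derivation_ne_zero`).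

Write `f_j = [u^j] F`, and let `q_i` be `∂Q/∂y_i` evaluated at the solution. If `δ` kills `t` and
`u`, differentiating the equation and multiplying by `u^k` gives `(u^k - t H) δF = -t ∑_{j<k} u^j
w_j δf_j`, where `H = ∑ q_i u^(k-i)` and `w_j` is its part with `i > j` (`kernel_smul_derivation`).
Suppose `∂Q/∂y_k` is nonzero at the origin; then `H` and all `w_j` are units of `A[[u]]`, with `A =
K[[t]]`. The quotient of `A[[u]]` by `u^k - t H` is totally ramified of degree `k` over `A`, and `u`
behaves as an element of valuation `1/k`, so the `u^j w_j` with `j < k` are independent over `A`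
(`linearIndependent_kernelQuotient`). The left side vanishes there, hence every `δf_j = 0` and the
`f_j` are algebraic. The same identity over `K(t,u)`, where the kernel is nonzero, then gives `δF =
0`.

In general `Q` is replaced by `Q + ε y_k`, which is nondegenerate over `K(ε)`, and `ε` is
specialized to `0` (`isAlgebraic_map_of_ker_eq_span`). Specializing `u` to `0` in the iterates of
`Δ` gives the coefficients of `F`. -/

/-! ### Derivations and algebraicity in characteristic zero -/

open TensorProduct in
/-- Derivations extend along formally étale algebras. -/
theorem exists_derivation_extends (R : Type*) {S T : Type*} [CommRing R] [CommRing S] [CommRing T]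
    [Algebra R S] [Algebra R T] [Algebra S T] [IsScalarTower R S T] [Algebra.FormallyEtale S T]
    (d : Derivation R S T) : ∃ D : Derivation R T T, ∀ s, D (algebraMap S T s) = d s := by
  let e := KaehlerDifferential.tensorKaehlerEquivOfFormallyEtale R S T
  refine ⟨((d.liftKaehlerDifferential.liftBaseChange T).comp e.symm.toLinearMap).compDer
    (KaehlerDifferential.D R T), fun s => ?_⟩
  have h := KaehlerDifferential.tensorKaehlerEquivOfFormallyEtale_symm_D_algebraMap R S T s
  change (d.liftKaehlerDifferential.liftBaseChange T) (e.symm _) = _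
  exact (congrArg (d.liftKaehlerDifferential.liftBaseChange T) h).trans (by simp)

open scoped IntermediateField.algebraAdjoinAdjoin in
/-- In characteristic zero, a transcendental element is not killed by some derivation. -/
theorem exists_derivation_ne_zero {k L : Type*} [Field k] [Field L] [CharZero k] [Algebra k L]
    {x : L} (hx : Transcendental k x) : ∃ D : Derivation k L L, D x ≠ 0 := by
  classical
  have hind : AlgebraicIndepOn k id ({x} : Set L) := by
    rw [AlgebraicIndepOn, algebraicIndependent_unique_type_iff]
    exact hx
  obtain ⟨B, hxB, hB⟩ := exists_isTranscendenceBasis_superset hind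
  rw [Set.singleton_subset_iff] at hxB
  set v : B → L := Subtype.val
  let S := Algebra.adjoin k (Set.range v)
  let E := IntermediateField.adjoin k (Set.range v)
  have halg : Algebra.IsAlgebraic S L := hB.isAlgebraic
  have halg' : Algebra.IsAlgebraic E L := (IsFractionRing.comap_isAlgebraic_iff (A := S)).1 halg
  have : Algebra.FormallyEtale E L := Algebra.FormallyEtale.of_isSeparable E L
  have : Algebra.FormallyEtale S E := .of_isLocalization (nonZeroDivisors S)
  have : Algebra.FormallyEtale S L := .comp S E L
  let e : MvPolynomial B k ≃ₐ[k] S := hB.1.aevalEquiv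
  have he : ∀ p, (e p : L) = MvPolynomial.aeval v p := hB.1.algebraMap_aevalEquiv
  let b : B := ⟨x, hxB⟩
  -- This is `∂/∂x` on the polynomial ring `k[B]`; it extends to `L` through a localization followed
  -- by a separable algebraic extension.
  let dl : S →ₗ[k] L := (MvPolynomial.aeval v).toLinearMap ∘ₗ
    (MvPolynomial.pderiv b).toLinearMap ∘ₗ e.symm.toLinearMap
  have hev : ∀ s : S, MvPolynomial.aeval v (e.symm s) = (s : L) := fun s => by
    rw [← he, e.apply_symm_apply]
  let d : Derivation k S L := Derivation.mk' dl fun s s' => by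
    simp [dl, hev, Algebra.smul_def, Derivation.leibniz]
  obtain ⟨D, hD⟩ := exists_derivation_extends k d
  have hxS : x ∈ S := Algebra.subset_adjoin ⟨b, rfl⟩
  refine ⟨D, ?_⟩
  have h1 : e (MvPolynomial.X b) = ⟨x, hxS⟩ := Subtype.ext (by rw [he, MvPolynomial.aeval_X])
  have h2 : D x = d ⟨x, hxS⟩ := hD ⟨x, hxS⟩
  rw [h2, ← h1]
  simp [d, dl]

/-- In characteristic zero, derivations kill algebraic elements. -/
theorem derivation_eq_zero_of_isAlgebraic {k L : Type*} [Field k] [Field L] [CharZero k]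
    [Algebra k L] (D : Derivation k L L) {x : L} (hx : IsAlgebraic k x) : D x = 0 := by
  have h := D.map_aeval (minpoly k x) x
  rw [minpoly.aeval, map_zero, smul_eq_mul, eq_comm, mul_eq_zero] at h
  exact h.resolve_left
    ((minpoly.irreducible hx.isIntegral).separable.aeval_derivative_ne_zero (minpoly.aeval k x))

/-! ### The linearized equation and its kernel -/

/-- The chain rule for the evaluation of a multivariate polynomial. -/
theorem derivation_mvAeval {σ K Z N : Type*} [Fintype σ] [CommRing K] [CommRing Z] [Algebra K Z]
    [AddCommGroup N] [Module Z N] [Module K N] [IsScalarTower K Z N] (δ : Derivation K Z N)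
    (y : σ → Z) (Q : MvPolynomial σ K) :
    δ (MvPolynomial.aeval y Q) =
      ∑ i, MvPolynomial.aeval y (MvPolynomial.pderiv i Q) • δ (y i) := by
  classical
  induction Q using MvPolynomial.induction_on with
  | C a => simp
  | add p q hp hq => simp [hp, hq, add_smul, Finset.sum_add_distrib]
  | mul_X p i hp =>
    simp only [map_mul, MvPolynomial.aeval_X, Derivation.leibniz, hp, smul_eq_mul, map_add,
      MvPolynomial.pderiv_X, add_smul, Finset.sum_add_distrib, Finset.smul_sum, mul_smul]
    congr 1
    rw [Finset.sum_eq_single i]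
    · simp
    · intro j _ hj
      simp [hj.symm]
    · simp

/-- The sum of the terms of index at least `j` of `∑ i ≤ k, q i * u ^ (k - i)`. -/
noncomputable def kernelSum {k : ℕ} {Z : Type*} [CommRing Z] (q : Fin (k + 1) → Z) (u : Z)
    (j : ℕ) : Z :=
  ∑ i : Fin (k + 1), if j ≤ (i : ℕ) then q i * u ^ (k - (i : ℕ)) else 0

theorem map_kernelSum {k : ℕ} {Z Z' : Type*} [CommRing Z] [CommRing Z'] (φ : Z →+* Z')
    (q : Fin (k + 1) → Z) (u : Z) (j : ℕ) :
    φ (kernelSum q u j) = kernelSum (fun i => φ (q i)) (φ u) j := by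
  simp only [kernelSum, map_sum, apply_ite φ, map_mul, map_pow, map_zero]

/-- Only `i = k` carries no power of `u`; hence the kernel sums are invertible as soon as `∂Q/∂y_k`
is. -/
theorem kernelSum_zero_right {k : ℕ} {Z : Type*} [CommRing Z] (q : Fin (k + 1) → Z) {j : ℕ}
    (hj : j ≤ k) : kernelSum q 0 j = q (Fin.last k) := by
  rw [kernelSum, Finset.sum_eq_single (Fin.last k)]
  · simp [hj]
  · intro i _ hi
    have : (i : ℕ) < k := Fin.val_lt_last hi
    rw [zero_pow (by omega), mul_zero, ite_self]
  · simp

theorem pow_smul_derivation {K Z N : Type*} [CommRing K] [CommRing Z] [Algebra K Z]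
    [AddCommGroup N] [Module Z N] [Module K N] (δ : Derivation K Z N) {y f : ℕ → Z} {u : Z}
    (hy : ∀ i, u * y (i + 1) = y i - f i) (hu : δ u = 0) (i : ℕ) :
    u ^ i • δ (y i) = δ (y 0) - ∑ j ∈ Finset.range i, u ^ j • δ (f j) := by
  induction i with
  | zero => simp
  | succ i ih =>
    have h : u • δ (y (i + 1)) = δ (y i) - δ (f i) := by
      have := congrArg δ (hy i)
      simpa [Derivation.leibniz, hu] using this
    rw [pow_succ, mul_smul, h, smul_sub, ih, Finset.sum_range_succ]
    abel

/-- Differentiating the catalytic equation along a derivation that kills `t` and `u`. -/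
theorem kernel_smul_derivation {K Z N : Type*} [CommRing K] [CommRing Z] [Algebra K Z]
    [AddCommGroup N] [Module Z N] [Module K N] [IsScalarTower K Z N] (δ : Derivation K Z N)
    {k : ℕ} (F₀ : Polynomial K) (Q : MvPolynomial (Fin (k + 1) ⊕ Fin 2) K) {y f : ℕ → Z} {t u : Z}
    (hy : ∀ i, u * y (i + 1) = y i - f i)
    (h0 : y 0 = Polynomial.aeval u F₀ +
      t * MvPolynomial.aeval (Sum.elim (fun i : Fin (k + 1) => y i) ![t, u]) Q)
    {q : Fin (k + 1) → Z}
    (hq : ∀ i, q i = MvPolynomial.aeval (Sum.elim (fun i : Fin (k + 1) => y i) ![t, u])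
      (MvPolynomial.pderiv (Sum.inl i) Q))
    (ht : δ t = 0) (hu : δ u = 0) :
    (u ^ k - t * kernelSum q u 0) • δ (y 0) =
      -(t • ∑ j : Fin k, (u ^ (j : ℕ) * kernelSum q u (j + 1)) • δ (f j)) := by
  have h1 : δ (y 0) = t • ∑ i : Fin (k + 1), q i • δ (y i) := by
    conv_lhs => rw [h0]
    simp [Derivation.map_aeval, hu, ht, Derivation.leibniz, derivation_mvAeval, hq]
  have h2 : ∀ i : Fin (k + 1), u ^ k • q i • δ (y i) = (q i * u ^ (k - (i : ℕ))) • δ (y 0) -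
      ∑ j : Fin k, if (j : ℕ) + 1 ≤ i then
        (u ^ (j : ℕ) * (q i * u ^ (k - (i : ℕ)))) • δ (f j) else 0 := fun i => by
    have hi : (i : ℕ) ≤ k := Nat.lt_succ_iff.1 i.2
    have e1 : u ^ k • q i • δ (y i) = (q i * u ^ (k - (i : ℕ))) • (u ^ (i : ℕ) • δ (y i)) := by
      rw [smul_smul, smul_smul, mul_assoc, ← pow_add, Nat.sub_add_cancel hi, mul_comm]
    rw [e1, pow_smul_derivation δ hy hu, smul_sub, Finset.smul_sum]
    congr 1
    rw [Fin.sum_univ_eq_sum_range (fun j => if j + 1 ≤ (i : ℕ) then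
        (u ^ j * (q i * u ^ (k - (i : ℕ)))) • δ (f j) else 0) k, ← Finset.sum_filter]
    have : (Finset.range k).filter (fun j => j + 1 ≤ (i : ℕ)) = Finset.range i := by
      ext j; simp; omega
    rw [this]
    exact Finset.sum_congr rfl fun j _ => by rw [smul_smul, mul_comm]
  have h3 : u ^ k • δ (y 0) = t • ∑ i : Fin (k + 1), u ^ k • q i • δ (y i) := by
    conv_lhs => rw [h1]
    rw [smul_comm, Finset.smul_sum]
  rw [sub_smul, h3, mul_smul, ← smul_sub, ← smul_neg]
  congr 1
  simp only [h2, Finset.sum_sub_distrib, kernelSum, Nat.zero_le, if_true, Finset.sum_smul]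
  -- Exchanging the sums collects, for each `j`, the terms with `i > j`.
  rw [sub_sub_cancel_left, Finset.sum_comm]
  congr 1
  refine Finset.sum_congr rfl fun j _ => ?_
  rw [Finset.mul_sum, Finset.sum_smul]
  refine Finset.sum_congr rfl fun i _ => ?_
  split_ifs <;> simp

open PowerSeries

/-! ### The quotient of `A[[u]]` by the kernel -/

section KernelQuotient

variable {A : Type*} [CommRing A]

/-- The series `u ^ k - ϖ * H`. -/
noncomputable def kernelSeries (ϖ : A) (k : ℕ) (H : A⟦X⟧) : A⟦X⟧ := X ^ k - C ϖ * H

theorem not_isUnit_mk_X {ϖ : A} {k : ℕ} {H : A⟦X⟧} (hϖ : Irreducible ϖ) (hk : k ≠ 0) :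
    ¬ IsUnit (Ideal.Quotient.mk (Ideal.span {kernelSeries ϖ k H}) X) := by
  intro hu
  obtain ⟨b, hb⟩ := hu.exists_right_inv
  obtain ⟨b, rfl⟩ := Ideal.Quotient.mk_surjective b
  rw [← map_mul, ← map_one (Ideal.Quotient.mk _), Ideal.Quotient.mk_eq_mk_iff_sub_mem,
    Ideal.mem_span_singleton] at hb
  obtain ⟨c, hc⟩ := hb
  have h := congrArg constantCoeff hc
  simp only [map_sub, map_mul, constantCoeff_X, zero_mul, map_one, kernelSeries, map_pow,
    zero_pow hk, constantCoeff_C] at h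
  exact hϖ.not_isUnit (IsUnit.of_mul_eq_one (constantCoeff H * constantCoeff c)
    (by linear_combination h))

variable [IsDomain A] [IsDiscreteValuationRing A] {ϖ : A}

theorem map_residue_kernelSeries (hϖ : Irreducible ϖ) (k : ℕ) (H : A⟦X⟧) :
    (kernelSeries ϖ k H).map (IsLocalRing.residue A) = X ^ k := by
  have : IsLocalRing.residue A ϖ = 0 := by
    rw [IsLocalRing.residue_eq_zero_iff, hϖ.maximalIdeal_eq]
    exact Ideal.mem_span_singleton_self _
  simp [kernelSeries, this]

/-- The constant term of the kernel is `-ϖ H(0)` with `H(0)` a unit, so it is divisible by `ϖ`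
exactly once, and `ϖ² ∣ f(0)` is impossible. -/
theorem isEisensteinAt_of_kernelSeries (hϖ : Irreducible ϖ) {k : ℕ} (hk : k ≠ 0) {H : A⟦X⟧}
    (hH : IsUnit (constantCoeff H)) {f : Polynomial A} {h : A⟦X⟧}
    (hf : (kernelSeries ϖ k H).IsWeierstrassFactorization f h) :
    f.IsEisensteinAt (IsLocalRing.maximalIdeal A) where
  leading := by
    rw [hf.isDistinguishedAt.monic.leadingCoeff]
    exact (Ideal.ne_top_iff_one _).1 (IsLocalRing.maximalIdeal.isMaximal _).ne_top
  mem := hf.isDistinguishedAt.mem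
  notMem hmem := by
    have h0 := congrArg constantCoeff hf.eq_mul
    have hf0 : constantCoeff (f : A⟦X⟧) = f.coeff 0 := by
      rw [← coeff_zero_eq_constantCoeff_apply, Polynomial.coeff_coe]
    rw [hϖ.maximalIdeal_eq, Ideal.span_singleton_pow, Ideal.mem_span_singleton] at hmem
    obtain ⟨a, ha⟩ := hmem
    simp only [kernelSeries, map_sub, map_pow, constantCoeff_X, zero_pow hk, map_mul,
      constantCoeff_C, hf0, ha, zero_sub] at h0
    have h1 : ϖ * (constantCoeff H + ϖ * (a * constantCoeff h)) = 0 := by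
      linear_combination -h0
    have h2 := (mul_eq_zero.1 h1).resolve_left hϖ.ne_zero
    exact hϖ.not_isUnit (isUnit_of_dvd_unit ⟨-(a * constantCoeff h), by linear_combination h2⟩ hH)

variable [IsAdicComplete (IsLocalRing.maximalIdeal A) A]

theorem exists_isWeierstrassFactorization_kernelSeries (hϖ : Irreducible ϖ) (k : ℕ) (H : A⟦X⟧) :
    ∃ f h, (kernelSeries ϖ k H).IsWeierstrassFactorization f h ∧ f.natDegree = k := by
  have hne : (kernelSeries ϖ k H).map (IsLocalRing.residue A) ≠ 0 := by
    rw [map_residue_kernelSeries hϖ]; exact pow_ne_zero _ X_ne_zero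
  obtain ⟨f, h, hf⟩ := exists_isWeierstrassFactorization hne
  refine ⟨f, h, hf, ?_⟩
  rw [hf.natDegree_eq_toNat_order_map, map_residue_kernelSeries hϖ, order_X_pow]
  simp

variable {k : ℕ} {H : A⟦X⟧}

/-- By Weierstrass division the quotient is `A[X]/(f)` with `f` Eisenstein, hence irreducible, hence
prime in the factorial ring `A[X]`. -/
theorem isDomain_kernelQuotient (hϖ : Irreducible ϖ) (hk : k ≠ 0) (hH : IsUnit (constantCoeff H)) :
    IsDomain (A⟦X⟧ ⧸ Ideal.span {kernelSeries ϖ k H}) := by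
  obtain ⟨f, h, hf, hd⟩ := exists_isWeierstrassFactorization_kernelSeries hϖ k H
  have hirr : Irreducible f := (isEisensteinAt_of_kernelSeries hϖ hk hH hf).irreducible
    inferInstance hf.isDistinguishedAt.monic.isPrimitive (by omega)
  have : (Ideal.span {f}).IsPrime := (Ideal.span_singleton_prime hirr.ne_zero).2 hirr.prime
  have : IsDomain (Polynomial A ⧸ Ideal.span {f}) := Ideal.Quotient.isDomain _
  exact hf.algEquivQuotient.toMulEquiv.symm.isDomain _

theorem isIntegral_kernelQuotient (hϖ : Irreducible ϖ) :
    Algebra.IsIntegral A (A⟦X⟧ ⧸ Ideal.span {kernelSeries ϖ k H}) := by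
  obtain ⟨f, h, hf, hd⟩ := exists_isWeierstrassFactorization_kernelSeries hϖ k H
  have := hf.isDistinguishedAt.monic.finite_quotient
  have : Module.Finite A (A⟦X⟧ ⧸ Ideal.span {kernelSeries ϖ k H}) :=
    Module.Finite.equiv hf.algEquivQuotient.toLinearEquiv
  infer_instance

/-- A monic polynomial of positive degree divides no nonzero constant. -/
theorem algebraMap_kernelQuotient_injective (hϖ : Irreducible ϖ) (hk : k ≠ 0) :
    Function.Injective
      (algebraMap A (A⟦X⟧ ⧸ Ideal.span {kernelSeries ϖ k H})) := by
  obtain ⟨f, h, hf, hd⟩ := exists_isWeierstrassFactorization_kernelSeries hϖ k H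
  rw [injective_iff_map_eq_zero]
  intro a ha
  rw [← hf.algEquivQuotient.commutes, EmbeddingLike.map_eq_zero_iff] at ha
  have hdvd : f ∣ Polynomial.C a := by
    rw [← Ideal.mem_span_singleton, ← Ideal.Quotient.eq_zero_iff_mem]
    exact ha
  by_contra hne
  have := Polynomial.natDegree_le_of_dvd hdvd (Polynomial.C_ne_zero.2 hne)
  rw [Polynomial.natDegree_C] at this
  omega

/-- In the quotient by `u ^ k - ϖ * H`, where `H` is invertible, the elements `u ^ j * w j` with
`j < k` and `w j` invertible are linearly independent over `A`. -/
theorem linearIndependent_kernelQuotient (hϖ : Irreducible ϖ) (hk : k ≠ 0) (hH : IsUnit (constantCoeff H))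
    {w : Fin k → A⟦X⟧} (hw : ∀ j, IsUnit (constantCoeff (w j))) :
    LinearIndependent A fun j : Fin k =>
      Ideal.Quotient.mk (Ideal.span {kernelSeries ϖ k H}) (X ^ (j : ℕ) * w j) := by
  have := isDomain_kernelQuotient hϖ hk hH
  set π := Ideal.Quotient.mk (Ideal.span {kernelSeries ϖ k H})
  have hunit : ∀ z : A⟦X⟧, IsUnit (constantCoeff z) → IsUnit (π z) := fun z hz =>
    (isUnit_iff_constantCoeff.2 hz).map π
  have hinj := algebraMap_kernelQuotient_injective (H := H) hϖ hk
  have hXk : π X ^ k = π (C ϖ) * π H := by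
    rw [← map_pow, ← map_mul, ← sub_eq_zero, ← map_sub, Ideal.Quotient.eq_zero_iff_mem]
    exact Ideal.mem_span_singleton_self _
  have hC : ∀ a : A, algebraMap A (A⟦X⟧ ⧸ Ideal.span {kernelSeries ϖ k H}) a = π (C a) :=
    fun a => rfl
  have hsmul : ∀ (a : A) (z : A⟦X⟧), a • π z = π (C a) * π z := fun a z => by
    rw [← map_mul, ← smul_eq_C_mul]; rfl
  have ht0 : π (C ϖ) ≠ 0 := by
    rw [← hC, Ne, map_eq_zero_iff _ hinj]; exact hϖ.ne_zero
  have hX0 : π X ≠ 0 := fun h0 => by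
    rw [h0, zero_pow hk, eq_comm, mul_eq_zero] at hXk
    exact hXk.elim ht0 (hunit H hH).ne_zero
  have hXt : π X ^ k ∣ π (C ϖ) := by
    rw [hXk, (hunit H hH).mul_right_dvd]
  -- Induction on the index `n`: the terms before `n` are divisible by `ϖ`, hence by `u^k`, and
  -- those after it by `u^(n+1)`. If `ϖ ∤ b n`, then `b n` is a unit and term `n` is a unit times
  -- `u^n`, which would make `u` a unit.
  have hstep : ∀ b : Fin k → A, ∑ j, b j • π (X ^ (j : ℕ) * w j) = 0 → ∀ j, ϖ ∣ b j := by
    intro b hb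
    suffices ∀ n (hn : n < k), ϖ ∣ b ⟨n, hn⟩ from fun j => this j j.2
    intro n
    induction n using Nat.strong_induction_on with
    | _ n ih =>
    intro hn
    by_contra hb'
    have hbu : IsUnit (π (C (b ⟨n, hn⟩))) := by
      refine IsUnit.map π (IsUnit.map C ?_)
      by_contra hnu
      rw [← mem_nonunits_iff, ← IsLocalRing.mem_maximalIdeal, hϖ.maximalIdeal_eq,
        Ideal.mem_span_singleton] at hnu
      exact hb' hnu
    have hdvd : π X ^ (n + 1) ∣ b ⟨n, hn⟩ • π (X ^ n * w ⟨n, hn⟩) := by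
      rw [← Finset.add_sum_erase _ _ (Finset.mem_univ (⟨n, hn⟩ : Fin k)),
        add_eq_zero_iff_eq_neg] at hb
      rw [hb]
      refine dvd_neg.2 (Finset.dvd_sum fun j hj => ?_)
      rw [hsmul, map_mul, map_pow]
      have hjn : (j : ℕ) ≠ n := fun h => (Finset.mem_erase.1 hj).1 (Fin.ext h)
      rcases lt_or_gt_of_ne hjn with h | h
      · obtain ⟨c, hc⟩ := ih j h j.2
        rw [show b j = ϖ * c from hc, map_mul, map_mul]
        exact (((pow_dvd_pow _ (by omega)).trans hXt).mul_right _).mul_right _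
      · exact ((pow_dvd_pow _ (by omega)).mul_right _).mul_left _
    rw [hsmul, map_mul, map_pow, pow_succ, mul_left_comm] at hdvd
    have := (mul_dvd_mul_iff_left (pow_ne_zero n hX0)).1 hdvd
    exact not_isUnit_mk_X hϖ hk (isUnit_of_dvd_unit this (hbu.mul (hunit _ (hw _))))
  -- A relation can be divided by `ϖ` again and again, so its coefficients are infinitely divisible
  -- by `ϖ`.
  have hpow : ∀ n (b : Fin k → A), ∑ j, b j • π (X ^ (j : ℕ) * w j) = 0 →
      ∀ j, ϖ ^ n ∣ b j := by
    intro n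
    induction n with
    | zero => simp
    | succ n ih =>
      intro b hb j
      choose c hc using hstep b hb
      have hc0 : ∑ j, c j • π (X ^ (j : ℕ) * w j) = 0 := by
        refine (mul_eq_zero.1 (?_ : π (C ϖ) * _ = 0)).resolve_left ht0
        rw [Finset.mul_sum, ← hb]
        refine Finset.sum_congr rfl fun i _ => ?_
        rw [hsmul, hsmul, hc i, map_mul C, map_mul π (C ϖ), mul_assoc]
      rw [hc j, pow_succ']
      exact mul_dvd_mul_left _ (ih c hc0 j)
  rw [Fintype.linearIndependent_iff]
  intro b hb j
  by_contra hne
  obtain ⟨n, hn⟩ := FiniteMultiplicity.of_not_isUnit hϖ.not_isUnit hne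
  exact hn (hpow (n + 1) b hb j)

end KernelQuotient

/-! ### Vanishing of derivations on the unknown coefficients -/

/-- A derivation of the fraction field of a complete discrete valuation ring `A` that kills the
uniformizer `ϖ` also kills the first `k` coefficients of a solution in `A[[u]]` of a nondegenerate
catalytic equation with `t = ϖ`. -/
theorem derivation_coeff_eq_zero {K A : Type*} [Field K] [CharZero K] [CommRing A] [IsDomain A]
    [IsDiscreteValuationRing A] [IsAdicComplete (IsLocalRing.maximalIdeal A) A] [Algebra K A]
    {ϖ : A} (hϖ : Irreducible ϖ) {k : ℕ} (F₀ : Polynomial K)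
    (Q : MvPolynomial (Fin (k + 1) ⊕ Fin 2) K) {y : ℕ → A⟦X⟧} {f : ℕ → A}
    (hy : ∀ i, X * y (i + 1) = y i - C (f i))
    (h0 : y 0 = Polynomial.aeval X F₀ +
      C ϖ * MvPolynomial.aeval (Sum.elim (fun i : Fin (k + 1) => y i) ![C ϖ, X]) Q)
    (hQ : IsUnit (constantCoeff (MvPolynomial.aeval
      (Sum.elim (fun i : Fin (k + 1) => y i) ![C ϖ, X])
      (MvPolynomial.pderiv (Sum.inl (Fin.last k)) Q))))
    (D₀ : Derivation K (FractionRing A) (FractionRing A))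
    (hD₀ : D₀ (algebraMap A (FractionRing A) ϖ) = 0) (j : Fin k) :
    D₀ (algebraMap A (FractionRing A) (f j)) = 0 := by
  have hk : k ≠ 0 := by have := j.2; omega
  set q : Fin (k + 1) → A⟦X⟧ := fun i =>
    MvPolynomial.aeval (Sum.elim (fun i : Fin (k + 1) => y i) ![C ϖ, X])
      (MvPolynomial.pderiv (Sum.inl i) Q)
  have hunit : ∀ m ≤ k, IsUnit (constantCoeff (kernelSum q X m)) := fun m hm => by
    rw [map_kernelSum, constantCoeff_X, kernelSum_zero_right _ hm]
    exact hQ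
  set H := kernelSum q X 0
  have hH : IsUnit (constantCoeff H) := hunit 0 (Nat.zero_le k)
  let B := A⟦X⟧ ⧸ Ideal.span {kernelSeries ϖ k H}
  have hdom : IsDomain B := isDomain_kernelQuotient hϖ hk hH
  have hBint : Algebra.IsIntegral A B := isIntegral_kernelQuotient hϖ
  have hinj : Function.Injective (algebraMap A B) := algebraMap_kernelQuotient_injective hϖ hk
  let L := FractionRing B
  let M := FractionRing A
  have hfB : FaithfulSMul A B := (faithfulSMul_iff_algebraMap_injective A B).2 hinj
  have hinjL : Function.Injective (algebraMap A L) := by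
    rw [IsScalarTower.algebraMap_eq A B L]
    exact (IsFractionRing.injective B L).comp hinj
  have hfL : FaithfulSMul A L := (faithfulSMul_iff_algebraMap_injective A L).2 hinjL
  let : Algebra M L := FractionRing.liftAlgebra A L
  have : IsScalarTower A M L := FractionRing.isScalarTower_liftAlgebra A L
  have : IsScalarTower K M L := by
    refine IsScalarTower.of_algebraMap_eq fun x => ?_
    rw [IsScalarTower.algebraMap_apply K A M, ← IsScalarTower.algebraMap_apply A M L,
      ← IsScalarTower.algebraMap_apply K A L]
  have : Algebra.IsAlgebraic A L :=
    (IsFractionRing.isAlgebraic_iff' A B L).1 inferInstance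
  have : Algebra.IsAlgebraic M L :=
    (IsFractionRing.comap_isAlgebraic_iff (A := A)).1 inferInstance
  have : CharZero M := charZero_of_injective_algebraMap (algebraMap K M).injective
  have : Algebra.FormallyEtale M L := Algebra.FormallyEtale.of_isSeparable M L
  obtain ⟨D, hD⟩ := exists_derivation_extends K ((Algebra.linearMap M L).compDer D₀)
  have hDA : ∀ a : A, D (algebraMap A L a) = algebraMap M L (D₀ (algebraMap A M a)) := fun a => by
    rw [IsScalarTower.algebraMap_apply A M L, hD]; rfl
  -- `D` need not kill the image of `u`; subtracting `D(u) ∂/∂u` corrects this without changing the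
  -- values on `A`.
  let δ : Derivation K A⟦X⟧ L := D.compAlgebraMap A⟦X⟧ -
    (LinearMap.toSpanSingleton A⟦X⟧ L (D (algebraMap A⟦X⟧ L X))).compDer
      ((derivative A).restrictScalars K)
  have hδX : δ X = 0 := by
    change D (algebraMap A⟦X⟧ L X) - (derivative A X) • _ = 0
    rw [derivative_X, one_smul, sub_self]
  have hδC : ∀ a, δ (C a) = algebraMap M L (D₀ (algebraMap A M a)) := fun a => by
    change D (algebraMap A⟦X⟧ L (C a)) - (derivative A (C a)) • _ = _
    rw [derivative_C, zero_smul, sub_zero, ← hDA]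
    rfl
  have hmain := kernel_smul_derivation δ F₀ Q hy h0 (fun i => rfl)
    (by rw [hδC, hD₀, map_zero]) hδX
  have hker : algebraMap A⟦X⟧ L (X ^ k - C ϖ * H) = 0 := by
    rw [IsScalarTower.algebraMap_apply A⟦X⟧ B L]
    convert! map_zero (algebraMap B L)
    exact Ideal.Quotient.eq_zero_iff_mem.2 (Ideal.mem_span_singleton_self _)
  rw [Algebra.smul_def, hker, zero_mul, eq_comm, neg_eq_zero, Algebra.smul_def, mul_eq_zero]
    at hmain
  have hsum := hmain.resolve_left 
    ((map_ne_zero_iff (algebraMap A L) hinjL).2 hϖ.ne_zero)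
  have hli := linearIndependent_kernelQuotient hϖ hk hH
    (w := fun j : Fin k => kernelSum q X (j + 1)) (fun j => hunit _ j.2)
  have hliL := (LinearIndependent.iff_fractionRing A M).1
    (hli.map' ((IsScalarTower.toAlgHom A B L).toLinearMap)
      (LinearMap.ker_eq_bot.2 (IsFractionRing.injective B L)))
  refine (map_eq_zero_iff _ (algebraMap M L).injective).1 ?_
  rw [Fintype.linearIndependent_iff] at hliL
  rw [hliL (fun j => D₀ (algebraMap A M (f j))) ?_ j, map_zero]
  rw [← hsum]
  refine Finset.sum_congr rfl fun j _ => ?_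
  rw [hδC, Algebra.smul_def, Algebra.smul_def, mul_comm]
  rfl

/-! ### Existence and uniqueness -/

/-- A contraction of `S[[X]]` for the `X`-adic topology has a unique fixed point. -/
theorem existsUnique_fixedPoint {S : Type*} [CommRing S] (Φ : S⟦X⟧ → S⟦X⟧)
    (hΦ : ∀ n F G, X ^ n ∣ F - G → X ^ (n + 1) ∣ Φ F - Φ G) : ∃! F, F = Φ F := by
  have hiter : ∀ n, X ^ n ∣ Φ^[n + 1] 0 - Φ^[n] 0 := by
    intro n
    induction n with
    | zero => simp
    | succ n ih =>
      have := hΦ _ _ _ ih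
      rwa [← Function.iterate_succ_apply' Φ, ← Function.iterate_succ_apply' Φ] at this
  have hle : ∀ m n, m ≤ n → X ^ m ∣ Φ^[n] 0 - Φ^[m] 0 := by
    intro m n hmn
    induction n, hmn using Nat.le_induction with
    | base => simp
    | succ n hmn ih =>
      rw [← sub_add_sub_cancel _ (Φ^[n] 0)]
      exact dvd_add ((pow_dvd_pow _ hmn).trans (hiter n)) ih
  -- The coefficient of `X^n` is stable only from iterate `n + 1` on.
  let F : S⟦X⟧ := mk fun n => coeff n (Φ^[n + 1] 0)
  have hF : ∀ n, X ^ n ∣ F - Φ^[n] 0 := fun n => by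
    rw [X_pow_dvd_iff]
    intro m hm
    have := X_pow_dvd_iff.1 (hle (m + 1) n hm) m (Nat.lt_succ_self m)
    rw [map_sub, sub_eq_zero] at this
    simp [F, this]
  refine ⟨F, ?_, fun G hG => ?_⟩
  · ext1 n
    have h1 := hΦ _ _ _ (hF n)
    rw [← Function.iterate_succ_apply' Φ n] at h1
    have := X_pow_dvd_iff.1 (dvd_sub (hF (n + 1)) h1) n (Nat.lt_succ_self n)
    simpa [sub_eq_zero] using this
  · have hFix : ∀ n, X ^ n ∣ G - Φ^[n] 0 := by
      intro n
      induction n with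
      | zero => simp
      | succ n ih =>
        rw [hG, Function.iterate_succ_apply' Φ n]
        exact hΦ _ _ _ ih
    ext1 n
    have := X_pow_dvd_iff.1 (dvd_sub (hFix (n + 1)) (hF (n + 1))) n (Nat.lt_succ_self n)
    simpa [sub_eq_zero] using this

/-! ### The equation over a commutative ring; exchange of variables -/

section CommRing

variable {R R' : Type*} [CommRing R] [CommRing R']

/-- The divided difference over an arbitrary commutative ring. -/
noncomputable def ddiff (F : (Polynomial R)⟦X⟧) : (Polynomial R)⟦X⟧ :=
  mk fun n => (coeff n F).divX

/-- The catalytic equation over an arbitrary commutative ring. -/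
def IsSol {k : ℕ} (F₀ : Polynomial R) (Q : MvPolynomial (Fin (k + 1) ⊕ Fin 2) R)
    (F : (Polynomial R)⟦X⟧) : Prop :=
  F = C F₀ + X * MvPolynomial.aeval
    (Sum.elim (fun i : Fin (k + 1) => ddiff^[(i : ℕ)] F) ![X, C Polynomial.X]) Q

theorem coeff_coeff_iterate_ddiff (F : (Polynomial R)⟦X⟧) (i n m : ℕ) :
    (coeff n (ddiff^[i] F)).coeff m = (coeff n F).coeff (m + i) := by
  induction i generalizing m with
  | zero => simp
  | succ i ih =>
    rw [Function.iterate_succ_apply', ddiff, coeff_mk, Polynomial.coeff_divX, ih]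
    congr 1
    omega

theorem X_pow_dvd_iterate_ddiff_sub {n : ℕ} {F G : (Polynomial R)⟦X⟧} (h : X ^ n ∣ F - G)
    (i : ℕ) : X ^ n ∣ ddiff^[i] F - ddiff^[i] G := by
  rw [X_pow_dvd_iff] at h ⊢
  intro m hm
  have := h m hm
  rw [map_sub, sub_eq_zero] at this ⊢
  ext l
  rw [coeff_coeff_iterate_ddiff, coeff_coeff_iterate_ddiff, this]

theorem dvd_mvAeval_sub {σ Z : Type*} [CommRing Z] [Algebra R Z] {z : Z} {y y' : σ → Z}
    (h : ∀ i, z ∣ y i - y' i) (Q : MvPolynomial σ R) :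
    z ∣ MvPolynomial.aeval y Q - MvPolynomial.aeval y' Q := by
  simp only [← Ideal.mem_span_singleton, ← Ideal.Quotient.mk_eq_mk_iff_sub_mem] at h ⊢
  rw [MvPolynomial.aeval_def, MvPolynomial.aeval_def, MvPolynomial.hom_eval₂,
    MvPolynomial.hom_eval₂]
  congr 1
  ext i
  exact h i

/-- `Δ` and `Q` preserve congruences modulo `t^n`, and the factor `t` gains one power. -/
theorem existsUnique_isSol {k : ℕ} (F₀ : Polynomial R)
    (Q : MvPolynomial (Fin (k + 1) ⊕ Fin 2) R) : ∃! F, IsSol F₀ Q F := by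
  refine existsUnique_fixedPoint (fun F => C F₀ + X * MvPolynomial.aeval
    (Sum.elim (fun i : Fin (k + 1) => ddiff^[(i : ℕ)] F) ![X, C Polynomial.X]) Q) ?_
  intro n F G h
  rw [add_sub_add_left_eq_sub, ← mul_sub, pow_succ']
  refine mul_dvd_mul_left _ (dvd_mvAeval_sub ?_ Q)
  rintro (i | i)
  · exact X_pow_dvd_iterate_ddiff_sub h i
  · simp

theorem map_iterate_ddiff (φ : R →+* R') (F : (Polynomial R)⟦X⟧) (i : ℕ) :
    map (Polynomial.mapRingHom φ) (ddiff^[i] F) =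
      ddiff^[i] (map (Polynomial.mapRingHom φ) F) := by
  ext n m
  simp [coeff_coeff_iterate_ddiff]

/-- Divided differences commute with base change. This serves both to pass to `K(ε)` and to set `ε =
0`. -/
theorem IsSol.map {k : ℕ} {F₀ : Polynomial R} {Q : MvPolynomial (Fin (k + 1) ⊕ Fin 2) R}
    {F : (Polynomial R)⟦X⟧} (hF : IsSol F₀ Q F) (φ : R →+* R') :
    IsSol (F₀.map φ) (MvPolynomial.map φ Q) (map (Polynomial.mapRingHom φ) F) := by
  have h := congrArg (PowerSeries.map (Polynomial.mapRingHom φ)) hF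
  rw [map_add, map_mul, map_C, map_X, MvPolynomial.aeval_def, MvPolynomial.hom_eval₂] at h
  rw [IsSol, MvPolynomial.aeval_def, MvPolynomial.eval₂_map]
  refine h.trans ?_
  congr 3
  · ext r : 1
    simp only [RingHom.comp_apply]
    rw [PowerSeries.algebraMap_apply, PowerSeries.algebraMap_apply, map_C]
    simp
  · funext i
    rcases i with i | i
    · exact map_iterate_ddiff φ F i
    · fin_cases i <;> simp

/-- Exchange of the two variables, `R[u][[t]] → R[[t]][[u]]`. -/
noncomputable def swapHom (R : Type*) [CommRing R] : (Polynomial R)⟦X⟧ →ₐ[R] R⟦X⟧⟦X⟧ where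
  toFun F := mk fun i => mk fun n => (coeff n F).coeff i
  map_zero' := by ext; simp
  map_one' := by
    ext i n
    simp only [coeff_mk, coeff_one]
    split_ifs <;> simp_all [Polynomial.coeff_one, coeff_one]
  map_add' F G := by ext; simp
  map_mul' F G := by
    ext i n
    simp only [coeff_mk, coeff_mul, map_sum, Polynomial.finsetSum_coeff, Polynomial.coeff_mul]
    exact Finset.sum_comm
  commutes' r := by
    ext i n
    simp only [PowerSeries.algebraMap_apply, coeff_mk, coeff_C]
    split_ifs <;> simp_all [Polynomial.coeff_C, coeff_C]

theorem coeff_coeff_swapHom (F : (Polynomial R)⟦X⟧) (i n : ℕ) :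
    coeff n (coeff i (swapHom R F)) = (coeff n F).coeff i := by
  simp [swapHom]

theorem swapHom_X : swapHom R X = C X := by
  ext i n
  rw [coeff_coeff_swapHom, coeff_X, coeff_C]
  split_ifs <;> simp_all [coeff_X, Polynomial.coeff_one]

theorem swapHom_C_X : swapHom R (C Polynomial.X) = X := by
  ext i n
  rw [coeff_coeff_swapHom, coeff_X, coeff_C]
  split_ifs <;> simp_all [coeff_one, Polynomial.coeff_X, eq_comm]

theorem swapHom_map_C (f : R⟦X⟧) : swapHom R (map Polynomial.C f) = C f := by
  ext i n
  rw [coeff_coeff_swapHom, coeff_map, coeff_C, Polynomial.coeff_C]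
  split_ifs <;> simp

theorem aeval_C_X (p : Polynomial R) :
    Polynomial.aeval (C Polynomial.X : (Polynomial R)⟦X⟧) p = C p := by
  induction p using Polynomial.induction_on' with
  | add p q hp hq => simp [hp, hq]
  | monomial n a =>
    rw [Polynomial.aeval_monomial, ← Polynomial.C_mul_X_pow_eq_monomial, PowerSeries.algebraMap_apply]
    simp

end CommRing

/-! ### From fields of rational functions to polynomial rings -/

/-- Algebraicity over the field `K(s)` is algebraicity over any ring `S` whose image is the
`K`-algebra generated by `s`. -/
theorem isAlgebraicOver_iff_isAlgebraic {K S Z : Type*} [Field K] [CommRing S] [IsDomain S]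
    [CommRing Z] [IsDomain Z] [Algebra K Z] [Algebra S Z] [FaithfulSMul S Z] {s : Set Z}
    (hs : ((algebraMap S Z).range : Set Z) = Algebra.adjoin K s) (a : Z) :
    IsAlgebraicOver K s a ↔ IsAlgebraic S a := by
  let N := FractionRing Z
  let E := IntermediateField.adjoin K (algebraMap Z N '' s)
  have hadj : Algebra.adjoin K (algebraMap Z N '' s) =
      (Algebra.adjoin K s).map (IsScalarTower.toAlgHom K Z N) := by
    rw [AlgHom.map_adjoin]; rfl
  have hmem : ∀ x : S, algebraMap S N x ∈ E := fun x => by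
    refine IntermediateField.algebra_adjoin_le_adjoin K _ ?_
    rw [hadj]
    refine ⟨algebraMap S Z x, ?_, rfl⟩
    change algebraMap S Z x ∈ (Algebra.adjoin K s : Set Z)
    rw [← hs]
    exact ⟨x, rfl⟩
  let : Algebra S E := ((algebraMap S N).codRestrict E.toSubring hmem).toAlgebra
  have : IsScalarTower S E N := IsScalarTower.of_algebraMap_eq fun x => rfl
  have hinj : Function.Injective (algebraMap S N) := by
    rw [IsScalarTower.algebraMap_eq S Z N]
    exact (IsFractionRing.injective Z N).comp (FaithfulSMul.algebraMap_injective S Z)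
  have : FaithfulSMul S E := by
    rw [faithfulSMul_iff_algebraMap_injective]
    intro x y h
    exact hinj (congrArg (algebraMap E N) h)
  have hlift : ∀ x ∈ Algebra.adjoin K (algebraMap Z N '' s), ∃ r : S, algebraMap S N r = x := by
    intro x hx
    rw [hadj] at hx
    obtain ⟨z, hz, rfl⟩ := hx
    change z ∈ (Algebra.adjoin K s : Set Z) at hz
    rw [← hs] at hz
    obtain ⟨r, rfl⟩ := hz
    exact ⟨r, rfl⟩
  have : IsFractionRing S E := .of_field _ _ fun ⟨z, h⟩ => by
    obtain ⟨x, hx, y, hy, eq⟩ := IntermediateField.mem_adjoin_iff_div.1 h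
    obtain ⟨x, rfl⟩ := hlift x hx
    obtain ⟨y, rfl⟩ := hlift y hy
    exact ⟨x, y, Subtype.ext eq⟩
  rw [IsAlgebraicOver, ← IsFractionRing.isAlgebraic_iff S E N,
    isAlgebraic_algebraMap_iff (IsFractionRing.injective Z N)]

section

variable {R : Type*} [CommRing R]

theorem algebraMap_polynomial_powerSeries (p : Polynomial R) :
    algebraMap (Polynomial R) R⟦X⟧ p = p := by
  rw [PowerSeries.algebraMap_apply', Algebra.algebraMap_self, map_id]; rfl

theorem algebraMap_comp_mapRingHom {R' : Type*} [CommRing R'] (φ : R →+* R') :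
    (algebraMap (Polynomial R') R'⟦X⟧).comp (Polynomial.mapRingHom φ) =
      (map φ).comp (algebraMap (Polynomial R) R⟦X⟧) := by
  refine RingHom.ext fun p => ?_
  simp only [RingHom.comp_apply, algebraMap_polynomial_powerSeries, Polynomial.coe_mapRingHom]
  exact Polynomial.polynomial_map_coe

instance : FaithfulSMul (Polynomial R) R⟦X⟧ := by
  rw [faithfulSMul_iff_algebraMap_injective]
  intro p q h
  rw [algebraMap_polynomial_powerSeries, algebraMap_polynomial_powerSeries] at h
  exact Polynomial.coe_injective R h

end

theorem isAlgebraicOver_X_iff {K : Type*} [Field K] (a : K⟦X⟧) :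
    IsAlgebraicOver K {(X : K⟦X⟧)} a ↔ IsAlgebraic (Polynomial K) a := by
  refine isAlgebraicOver_iff_isAlgebraic (Set.Subset.antisymm ?_ ?_) a
  · rintro _ ⟨p, rfl⟩
    rw [algebraMap_polynomial_powerSeries]
    induction p using Polynomial.induction_on' with
    | add p q hp hq =>
      rw [Polynomial.coe_add]
      exact add_mem hp hq
    | monomial n r =>
      rw [← Polynomial.C_mul_X_pow_eq_monomial, Polynomial.coe_mul, Polynomial.coe_pow,
        Polynomial.coe_C, Polynomial.coe_X]
      exact mul_mem (Subalgebra.algebraMap_mem _ r)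
        (pow_mem (Algebra.subset_adjoin (Set.mem_singleton _)) n)
  · intro x hx
    induction hx using Algebra.adjoin_induction with
    | mem x hx =>
      rw [Set.mem_singleton_iff.1 hx]
      exact ⟨Polynomial.X, by rw [algebraMap_polynomial_powerSeries, Polynomial.coe_X]⟩
    | algebraMap r =>
      exact ⟨Polynomial.C r, by rw [algebraMap_polynomial_powerSeries, Polynomial.coe_C]; rfl⟩
    | add x y _ _ hx hy => exact add_mem (S := Subring K⟦X⟧) hx hy
    | mul x y _ _ hx hy => exact mul_mem (S := Subring K⟦X⟧) hx hy

theorem isAlgebraicOver_tVar_uVar_iff {K : Type*} [Field K] (a : (Polynomial K)⟦X⟧) :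
    IsAlgebraicOver K {tVar K, uVar K} a ↔ IsAlgebraic (Polynomial (Polynomial K)) a := by
  refine isAlgebraicOver_iff_isAlgebraic (Set.Subset.antisymm ?_ ?_) a
  · have hC : ∀ p : Polynomial K, (C p : (Polynomial K)⟦X⟧) ∈
        Algebra.adjoin K {tVar K, uVar K} := fun p => by
      rw [← aeval_C_X]
      have hu : ({uVar K} : Set (Polynomial K)⟦X⟧) ⊆ {tVar K, uVar K} := by simp
      exact Algebra.adjoin_mono hu (Polynomial.aeval_mem_adjoin_singleton K _)
    rintro _ ⟨p, rfl⟩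
    rw [algebraMap_polynomial_powerSeries]
    induction p using Polynomial.induction_on' with
    | add p q hp hq =>
      rw [Polynomial.coe_add]
      exact add_mem hp hq
    | monomial n r =>
      rw [← Polynomial.C_mul_X_pow_eq_monomial, Polynomial.coe_mul, Polynomial.coe_pow,
        Polynomial.coe_C, Polynomial.coe_X]
      exact mul_mem (hC r) (pow_mem (Algebra.subset_adjoin (Set.mem_insert _ _)) n)
  · intro x hx
    induction hx using Algebra.adjoin_induction with
    | mem x hx =>
      rcases hx with rfl | hx
      · exact ⟨Polynomial.X, by
          rw [algebraMap_polynomial_powerSeries, Polynomial.coe_X]; rfl⟩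
      · rw [Set.mem_singleton_iff.1 hx]
        exact ⟨Polynomial.C Polynomial.X, by
          rw [algebraMap_polynomial_powerSeries, Polynomial.coe_C]; rfl⟩
    | algebraMap r =>
      exact ⟨Polynomial.C (Polynomial.C r), by
        rw [algebraMap_polynomial_powerSeries, Polynomial.coe_C, PowerSeries.algebraMap_apply]
        rfl⟩
    | add x y _ _ hx hy => exact add_mem (S := Subring (Polynomial K)⟦X⟧) hx hy
    | mul x y _ _ hx hy => exact mul_mem (S := Subring (Polynomial K)⟦X⟧) hx hy

/-! ### Change of coefficients in algebraic equations -/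

/-- Specialization along a ring homomorphism with principal kernel preserves algebraicity. -/
theorem isAlgebraic_map_of_ker_eq_span {R R' : Type*} [CommRing R] [IsDomain R]
    [IsNoetherianRing R] [CommRing R'] [Nontrivial R'] (e : R →+* R') {ϖ : R} (hϖ : ϖ ≠ 0)
    (he : RingHom.ker e = Ideal.span {ϖ}) {F : R⟦X⟧} (hF : IsAlgebraic (Polynomial R) F) :
    IsAlgebraic (Polynomial R') (map e F) := by
  obtain ⟨p, hp, hpF⟩ := hF
  have heϖ : e ϖ = 0 := by
    rw [← RingHom.mem_ker, he]; exact Ideal.mem_span_singleton_self ϖ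
  have hnu : ¬ IsUnit (Polynomial.C (Polynomial.C ϖ) : Polynomial (Polynomial R)) := by
    rw [Polynomial.isUnit_C, Polynomial.isUnit_C]
    intro h
    exact not_isUnit_zero (heϖ ▸ h.map e)
  -- Removing the largest power of `ϖ` from the equation keeps its specialization nonzero.
  obtain ⟨n, p, hndvd, rfl⟩ := WfDvdMonoid.max_power_factor' hp hnu
  have hroot : Polynomial.aeval F p = 0 := by
    rw [map_mul, map_pow, Polynomial.aeval_C, algebraMap_polynomial_powerSeries,
      Polynomial.coe_C] at hpF
    refine (mul_eq_zero.1 hpF).resolve_left (pow_ne_zero _ ?_)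
    rwa [Ne, map_eq_zero_iff _ PowerSeries.C_injective]
  refine ⟨p.map (Polynomial.mapRingHom e), fun h0 => hndvd ?_, ?_⟩
  · rw [Polynomial.C_dvd_iff_dvd_coeff]
    intro i
    rw [Polynomial.C_dvd_iff_dvd_coeff]
    intro j
    rw [← Ideal.mem_span_singleton, ← he, RingHom.mem_ker]
    have := congrArg (fun r => (r.coeff i).coeff j) h0
    simpa using this
  · have := congrArg (map e) hroot
    rw [Polynomial.aeval_def, Polynomial.hom_eval₂, map_zero] at this
    rw [Polynomial.aeval_def, Polynomial.eval₂_map, algebraMap_comp_mapRingHom, this]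

/-- Algebraicity is preserved by extension of the coefficients. -/
theorem IsAlgebraic.map_powerSeries {R R' : Type*} [CommRing R] [CommRing R'] {φ : R →+* R'}
    (hφ : Function.Injective φ) {F : R⟦X⟧} (hF : IsAlgebraic (Polynomial R) F) :
    IsAlgebraic (Polynomial R') (map φ F) := by
  obtain ⟨p, hp, hpF⟩ := hF
  refine ⟨p.map (Polynomial.mapRingHom φ), ?_, ?_⟩
  · rwa [Ne, Polynomial.map_eq_zero_iff (Polynomial.map_injective φ hφ)]
  · have := congrArg (map φ) hpF
    rw [Polynomial.aeval_def, Polynomial.hom_eval₂, map_zero] at this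
    rw [Polynomial.aeval_def, Polynomial.eval₂_map, algebraMap_comp_mapRingHom, this]

/-- The value of `P` at `t = u = 0` and `y_i = [u^i] F₀`. -/
noncomputable def evalOrigin {R : Type*} [CommRing R] {k : ℕ} (F₀ : Polynomial R)
    (P : MvPolynomial (Fin (k + 1) ⊕ Fin 2) R) : R :=
  MvPolynomial.eval (Sum.elim (fun i : Fin (k + 1) => F₀.coeff i) ![0, 0]) P

theorem evalOrigin_map {R R' : Type*} [CommRing R] [CommRing R'] {k : ℕ} (φ : R →+* R')
    (F₀ : Polynomial R) (P : MvPolynomial (Fin (k + 1) ⊕ Fin 2) R) :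
    evalOrigin (F₀.map φ) (MvPolynomial.map φ P) = φ (evalOrigin F₀ P) := by
  rw [evalOrigin, evalOrigin, MvPolynomial.map_eval]
  congr 2
  funext i
  rcases i with i | i
  · simp
  · fin_cases i <;> simp

/-! ### Nondegenerate equations over a field -/

section Field

variable {K : Type*} [Field K] {k : ℕ} {F₀ : Polynomial K}
  {Q : MvPolynomial (Fin (k + 1) ⊕ Fin 2) K} {F : (Polynomial K)⟦X⟧}

theorem uCoeff_zero_iterate_divDiff (F : (Polynomial K)⟦X⟧) (i : ℕ) :
    uCoeff 0 (divDiff^[i] F) = uCoeff i F := by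
  ext n
  simp only [uCoeff, coeff_mk]
  exact (coeff_coeff_iterate_ddiff F i n 0).trans (by rw [zero_add])

theorem uVar_mul_iterate_divDiff_succ (F : (Polynomial K)⟦X⟧) (i : ℕ) :
    uVar K * divDiff^[i + 1] F = divDiff^[i] F - map Polynomial.C (uCoeff i F) := by
  rw [Function.iterate_succ_apply', uVar_mul_divDiff, uCoeff_zero_iterate_divDiff]

theorem IsSolution.coeff_zero (hF : IsSolution F₀ Q F) : coeff 0 F = F₀ := by
  rw [hF]
  simp [tVar]

/-- At `t = u = 0` the series `Δ^(i) F` takes the value `[u^i] F₀`, so nondegeneracy can be read off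
from `F₀` and `Q` alone. -/
theorem constantCoeff_constantCoeff_mvAeval_swapHom (hF : IsSolution F₀ Q F)
    (P : MvPolynomial (Fin (k + 1) ⊕ Fin 2) K) :
    constantCoeff (constantCoeff (MvPolynomial.aeval (Sum.elim
      (fun i : Fin (k + 1) => swapHom K (divDiff^[(i : ℕ)] F)) ![C X, X]) P)) =
      evalOrigin F₀ P := by
  rw [MvPolynomial.aeval_def, MvPolynomial.hom_eval₂, MvPolynomial.hom_eval₂, evalOrigin,
    MvPolynomial.eval, MvPolynomial.coe_eval₂Hom]
  congr 1
  funext i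
  rcases i with i | i
  · simp only [Sum.elim_inl]
    rw [← coeff_zero_eq_constantCoeff_apply, ← coeff_zero_eq_constantCoeff_apply,
      coeff_coeff_swapHom]
    refine (coeff_coeff_iterate_ddiff F i 0 0).trans ?_
    rw [hF.coeff_zero, zero_add]
  · fin_cases i <;> simp

variable [CharZero K]

/-- The first `k` coefficients of the solution of a nondegenerate catalytic equation. -/
theorem isAlgebraicOver_uCoeff_of_nondegenerate (hF : IsSolution F₀ Q F)
    (hQ : evalOrigin F₀ (MvPolynomial.pderiv (Sum.inl (Fin.last k)) Q) ≠ 0) (j : Fin k) :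
    IsAlgebraicOver K {(X : K⟦X⟧)} (uCoeff j F) := by
  by_contra htr
  obtain ⟨D, hD⟩ := exists_derivation_ne_zero htr
  refine hD ?_
  have : IsAdicComplete (IsLocalRing.maximalIdeal K⟦X⟧) K⟦X⟧ := by
    rw [maximalIdeal_eq_span_X]; infer_instance
  refine derivation_coeff_eq_zero (A := K⟦X⟧) X_irreducible F₀ Q
    (y := fun i => swapHom K (divDiff^[i] F)) (f := fun i => uCoeff i F) (fun i => ?_) ?_ ?_
    (D.restrictScalars K) ?_ j
  · have := congrArg (swapHom K) (uVar_mul_iterate_divDiff_succ F i)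
    rwa [map_mul, map_sub, uVar, swapHom_C_X, swapHom_map_C] at this
  · have := congrArg (swapHom K) hF
    rw [← aeval_C_X, map_add, map_mul, ← Polynomial.aeval_algHom_apply, swapHom_C_X, tVar,
      swapHom_X, ← AlgHom.comp_apply, MvPolynomial.comp_aeval] at this
    refine this.trans ?_
    congr 4
    funext i
    rcases i with i | i
    · rfl
    · fin_cases i
      · exact swapHom_X
      · exact swapHom_C_X
  · rw [isUnit_iff_constantCoeff, constantCoeff_constantCoeff_mvAeval_swapHom hF]
    exact hQ.isUnit
  · exact D.map_algebraMap ⟨_, IntermediateField.subset_adjoin K _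
      (Set.mem_image_of_mem _ (Set.mem_singleton _))⟩

/-- A derivation over `K(t,u)` kills the algebraic series `f_j`, so the linearized equation reduces
to kernel times `δF` equals zero. -/
theorem isAlgebraicOver_of_nondegenerate (hF : IsSolution F₀ Q F)
    (hQ : evalOrigin F₀ (MvPolynomial.pderiv (Sum.inl (Fin.last k)) Q) ≠ 0) :
    IsAlgebraicOver K {tVar K, uVar K} F := by
  by_contra htr
  obtain ⟨D, hD⟩ := exists_derivation_ne_zero htr
  refine hD ?_
  let N := FractionRing (Polynomial K)⟦X⟧
  let δ : Derivation K (Polynomial K)⟦X⟧ N := (D.restrictScalars K).compAlgebraMap _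
  have hδ : ∀ z ∈ ({tVar K, uVar K} : Set (Polynomial K)⟦X⟧), δ z = 0 := fun z hz =>
    D.map_algebraMap ⟨_, IntermediateField.subset_adjoin K _ (Set.mem_image_of_mem _ hz)⟩
  have hcoeff : ∀ j : Fin k, δ (map Polynomial.C (uCoeff j F)) = 0 := fun j =>
    derivation_eq_zero_of_isAlgebraic D ((isAlgebraicOver_tVar_uVar_iff _).2
      (IsAlgebraic.map_powerSeries Polynomial.C_injective
        ((isAlgebraicOver_X_iff _).1 (isAlgebraicOver_uCoeff_of_nondegenerate hF hQ j))))
  have h := kernel_smul_derivation δ F₀ Q (y := fun i => divDiff^[i] F)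
    (uVar_mul_iterate_divDiff_succ F) (by rw [uVar, aeval_C_X]; exact hF) (fun i => rfl)
    (hδ _ (Or.inl rfl)) (hδ _ (Or.inr rfl))
  simp only [hcoeff, smul_zero, Finset.sum_const_zero, neg_zero] at h
  rw [Algebra.smul_def, mul_eq_zero, map_eq_zero_iff _ (IsFractionRing.injective _ N)] at h
  refine h.resolve_left fun h0 => ?_
  -- At `t = 0` the kernel is `u^k`, which is nonzero.
  have := congrArg constantCoeff h0
  simp [tVar, uVar] at this

end Field

/-! ### Deformation, and the coefficients of the solution -/

/-- Denominators of the coefficients can be cleared in an algebraic equation. -/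
theorem isAlgebraic_of_isAlgebraic_map {T T' : Type*} [CommRing T] [CommRing T'] [Algebra T T']
    (M : Submonoid T) [IsLocalization M T'] (hinj : Function.Injective (algebraMap T T'))
    {G : T⟦X⟧} (hG : IsAlgebraic (Polynomial T') (map (algebraMap T T') G)) :
    IsAlgebraic (Polynomial T) G := by
  let := Polynomial.algebra T T'
  have := Polynomial.isLocalization M T'
  obtain ⟨p, hp, hpG⟩ := hG
  obtain ⟨b, hb, hpb⟩ := IsLocalization.integerNormalization_spec (M.map Polynomial.C) p
  have hbu := IsLocalization.map_units (Polynomial T') (⟨b, hb⟩ : M.map Polynomial.C)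
  refine ⟨IsLocalization.integerNormalization (M.map Polynomial.C) p, fun h0 => hp ?_, ?_⟩
  · rw [h0, Polynomial.map_zero, Algebra.smul_def, eq_comm] at hpb
    exact ((hbu.map Polynomial.C).mul_right_eq_zero).1 hpb
  · apply PowerSeries.map_injective _ hinj
    rw [map_zero, Polynomial.aeval_def, Polynomial.hom_eval₂, ← algebraMap_comp_mapRingHom,
      ← Polynomial.eval₂_map, ← Polynomial.algebraMap_def, hpb, ← Polynomial.aeval_def,
      Algebra.smul_def, map_mul, hpG, mul_zero]

/-- Algebraicity of a solution, by a deformation with parameter `ε` to the nondegenerate case. -/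
theorem IsSolution.isAlgebraic_of_deformation {K R : Type*} [Field K] [CharZero K] [CommRing R]
    [IsDomain R] [IsNoetherianRing R] [Algebra K R] (e : R →ₐ[K] K) {ε : R} (hε : ε ≠ 0)
    (he : RingHom.ker (e : R →+* K) = Ideal.span {ε}) {k : ℕ} {F₀ : Polynomial K}
    {Q : MvPolynomial (Fin (k + 1) ⊕ Fin 2) K} {F : (Polynomial K)⟦X⟧}
    (hF : IsSolution F₀ Q F) : IsAlgebraic (Polynomial (Polynomial K)) F := by
  have heε : e ε = 0 := by
    have : ε ∈ RingHom.ker (e : R →+* K) := by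
      rw [he]; exact Ideal.mem_span_singleton_self ε
    exact this
  have hecomp : (e : R →+* K).comp (algebraMap K R) = RingHom.id K := RingHom.ext e.commutes
  let Q' : MvPolynomial (Fin (k + 1) ⊕ Fin 2) R := MvPolynomial.map (algebraMap K R) Q +
    MvPolynomial.C ε * MvPolynomial.X (Sum.inl (Fin.last k))
  obtain ⟨F', hF', -⟩ := existsUnique_isSol (F₀.map (algebraMap K R)) Q'
  have hspec : map (Polynomial.mapRingHom (e : R →+* K)) F' = F := by
    have h := hF'.map (e : R →+* K)
    have hQ : MvPolynomial.map (e : R →+* K) Q' = Q := by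
      simp [Q', MvPolynomial.map_map, hecomp, heε, MvPolynomial.map_id]
    rw [hQ, Polynomial.map_map, hecomp, Polynomial.map_id] at h
    exact (existsUnique_isSol F₀ Q).unique h hF
  let K' := FractionRing R
  have : CharZero K' := charZero_of_injective_algebraMap (algebraMap K K').injective
  have hsol := hF'.map (algebraMap R K')
  have hnd : evalOrigin ((F₀.map (algebraMap K R)).map (algebraMap R K'))
      (MvPolynomial.pderiv (Sum.inl (Fin.last k)) (MvPolynomial.map (algebraMap R K') Q')) ≠ 0 := by
    rw [MvPolynomial.pderiv_map, evalOrigin_map, Ne,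
      map_eq_zero_iff _ (IsFractionRing.injective R K')]
    have h1 : evalOrigin (F₀.map (algebraMap K R))
        (MvPolynomial.pderiv (Sum.inl (Fin.last k)) Q') =
        algebraMap K R (evalOrigin F₀ (MvPolynomial.pderiv (Sum.inl (Fin.last k)) Q)) + ε := by
      rw [← evalOrigin_map]
      simp [Q', evalOrigin, MvPolynomial.pderiv_map]
    rw [h1]
    intro h0
    -- If `c + ε = 0` with `c` in `K`, setting `ε = 0` gives `c = 0`, and then `ε = 0` in `R`.
    have h2 := congrArg e h0
    rw [map_add, heε, add_zero, map_zero, AlgHom.commutes, Algebra.algebraMap_self_apply] at h2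
    rw [h2, map_zero, zero_add] at h0
    exact hε h0
  have halg := (isAlgebraicOver_tVar_uVar_iff _).1 (isAlgebraicOver_of_nondegenerate hsol hnd)
  let := Polynomial.algebra R K'
  have := Polynomial.isLocalization (nonZeroDivisors R) K'
  have halgR : IsAlgebraic (Polynomial (Polynomial R)) F' :=
    isAlgebraic_of_isAlgebraic_map (T' := Polynomial K') ((nonZeroDivisors R).map Polynomial.C)
      (Polynomial.map_injective _ (IsFractionRing.injective R K')) halg
  rw [← hspec]
  refine isAlgebraic_map_of_ker_eq_span _ (Polynomial.C_ne_zero.2 hε) ?_ halgR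
  rw [Polynomial.ker_mapRingHom, he, Ideal.map_span, Set.image_singleton]

theorem IsSolution.isAlgebraic {K : Type*} [Field K] [CharZero K] {k : ℕ} {F₀ : Polynomial K}
    {Q : MvPolynomial (Fin (k + 1) ⊕ Fin 2) K} {F : (Polynomial K)⟦X⟧}
    (hF : IsSolution F₀ Q F) : IsAlgebraic (Polynomial (Polynomial K)) F := by
  refine hF.isAlgebraic_of_deformation (R := Polynomial K) (Polynomial.aeval 0)
    Polynomial.X_ne_zero ?_
  have := Polynomial.ker_evalRingHom (0 : K)
  rw [map_zero, sub_zero] at this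
  rw [← this]
  congr 1

/-- Setting `u = 0` is a specialization with kernel `(u)`. -/
theorem isAlgebraic_uCoeff_zero {K : Type*} [Field K] {F : (Polynomial K)⟦X⟧}
    (hF : IsAlgebraic (Polynomial (Polynomial K)) F) :
    IsAlgebraic (Polynomial K) (uCoeff 0 F) := by
  have h : uCoeff 0 F = map (Polynomial.evalRingHom 0) F := by
    ext n
    simp [uCoeff, Polynomial.coeff_zero_eq_eval_zero]
  rw [h]
  refine isAlgebraic_map_of_ker_eq_span _ Polynomial.X_ne_zero ?_ hF
  rw [Polynomial.ker_evalRingHom, map_zero, sub_zero]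

/-- In `u ΔG = G - G(0)` the right side is algebraic by the case `u = 0`, and the algebraic factor
`u ≠ 0` can be divided out. -/
theorem isAlgebraic_iterate_divDiff {K : Type*} [Field K] {F : (Polynomial K)⟦X⟧}
    (hF : IsAlgebraic (Polynomial (Polynomial K)) F) (i : ℕ) :
    IsAlgebraic (Polynomial (Polynomial K)) (divDiff^[i] F) := by
  induction i with
  | zero => exact hF
  | succ i ih =>
    have hu0 : uVar K ≠ 0 := by
      rw [uVar, Ne, map_eq_zero_iff _ PowerSeries.C_injective]
      exact Polynomial.X_ne_zero
    have hu : IsAlgebraic (Polynomial (Polynomial K)) (uVar K) := by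
      have := isAlgebraic_algebraMap (R := Polynomial (Polynomial K)) (A := (Polynomial K)⟦X⟧)
        (Polynomial.C Polynomial.X)
      rwa [algebraMap_polynomial_powerSeries, Polynomial.coe_C] at this
    refine IsAlgebraic.of_mul (mem_nonZeroDivisors_of_ne_zero hu0) hu ?_
    rw [Function.iterate_succ_apply', uVar_mul_divDiff]
    exact ih.sub (IsAlgebraic.map_powerSeries Polynomial.C_injective (isAlgebraic_uCoeff_zero ih))

end Catalytic

theorem mainTheorem1 {K : Type*} [Field K] [CharZero K] (k : ℕ) (F₀ : Polynomial K)
    (Q : MvPolynomial (Fin (k + 1) ⊕ Fin 2) K) :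
    (∃! F : PowerSeries (Polynomial K), Catalytic.IsSolution F₀ Q F) ∧
    ∀ F : PowerSeries (Polynomial K), Catalytic.IsSolution F₀ Q F →
      Catalytic.IsAlgebraicOver K {Catalytic.tVar K, Catalytic.uVar K} F ∧
      ∀ i : ℕ, Catalytic.IsAlgebraicOver K {(PowerSeries.X : PowerSeries K)}
        (Catalytic.uCoeff i F) := by
  refine ⟨Catalytic.existsUnique_isSol F₀ Q, fun F hF =>
    ⟨(Catalytic.isAlgebraicOver_tVar_uVar_iff F).2 hF.isAlgebraic, fun i => ?_⟩⟩
  -- `[u^i] F` is the value of `Δ^(i) F` at `u = 0`.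
  rw [Catalytic.isAlgebraicOver_X_iff, ← Catalytic.uCoeff_zero_iterate_divDiff]
  exact Catalytic.isAlgebraic_uCoeff_zero (Catalytic.isAlgebraic_iterate_divDiff hF.isAlgebraic i)
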